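/- Let $d\ge 0$ be an integer, $\epsilon>0$, $\alpha\in(0,1)$, $\sigma>0$, and $\ell<u$ real; put $\epsilon'=\epsilon/(d+1)$ and $C=\frac{e^{\epsilon'}+1}{e^{\epsilon'}-1}$. For reals $a<b$ let $t_{[a,b]}(v)=\max(a,\min(b,v))$. **Protocol.** Let $F_{\mathbf X}$ be an (unknown) probability distribution on $\mathbb R^d$ and $F(\cdot|\mathbf x)$ an (unknown) conditional probability distribution on $\mathbb R$. Each user $i$ independently draws $\mathbf X_i\sim F_{\mathbf X}$ and $Y_i\sim F(\cdot|\mathbf X_i)$, and submits $(\mathbf z_i,b_i)\in\{-1,1\}^d\times\{0,1\}$ drawn, given $(\mathbf X_i,Y_i)=(\mathbf x,y)$, with probability $Q(\mathbf z|\mathbf x)\,Q(b|y)$, where $$Q(\mathbf z|\mathbf x)=\prod_{j=1}^d\Big(\tfrac12+\tfrac{z_j\,t_{[-1,1]}(x_j)}{2C}\Big),\qquad Q(1|y)=\tfrac12+\frac{t_{[\ell,u]}(y)-\frac{\ell+u}{2}}{(u-\ell)C},\qquad Q(0|y)=1-Q(1|y).$$ Let $P$ be the resulting law of one submission, $P(\mathbf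 z,b)=\iint Q(\mathbf z|\mathbf x)Q(b|y)\,dF(y|\mathbf x)\,dF_{\mathbf X}(\mathbf x)$, and write $P g=\sum_{\mathbf z,b}P(\mathbf z,b)g(\mathbf z,b)$. **Model.** For $\beta\in\mathbb R^d$ let $f_\beta(y|\mathbf x)=\frac{\alpha(1-\alpha)}{\sigma}\exp\big(-\rho_\alpha(\frac{y-\langle\beta,\mathbf x\rangle}{\sigma})\big)$, where $\rho_\alpha(\tau)=(\alpha-1)\tau$ for $\tau\le 0$ and $\rho_\alpha(\tau)=\alpha\tau$ for $\tau>0$. With the uniform prior on $\{-1,1\}^d$ for the covariates, put $\Lambda(\beta,\mathbf x)=\int Q(1|y)f_\beta(y|\mathbf x)\,dy$, $$\hat p(\mathbf z)=2^{-d}\sum_{\mathbf x\in\{\pm1\}^d}Q(\mathbf z|\mathbf x),\qquad \Phi(\beta,\mathbf z)=\frac{2^{-d}\sum_{\mathbf x\in\{\pm1\}^d}\Lambda(\beta,\mathbf x)Q(\mathbf z|\mathbf x)}{\hat p(\mathbf z)},$$ and $p_\beta(\mathbf z,1)=\hat p(\mathbf z)\Phi(\beta,\mathbf z)$, $p_\beta(\mathbf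 z,0)=\hat p(\mathbf z)(1-\Phi(\beta,\mathbf z))$. Let $\mathcal B\subset\mathbb R^d$ be compact, and let the QMLE $\hat\beta_n$ be a random variable with values in $\mathcal B$ that maximizes $\frac1n\sum_{i=1}^n\log p_\beta(\mathbf z_i,b_i)$ over $\beta\in\mathcal B$. Put $$A(\beta)=P\,\frac{\partial^2\log p_\beta}{\partial\beta^2},\qquad B(\beta)=P\Big(\frac{\partial\log p_\beta}{\partial\beta}\Big)\Big(\frac{\partial\log p_\beta}{\partial\beta}\Big)^{\!\top},\qquad C(\beta)=A(\beta)^{-1}B(\beta)A(\beta)^{-1}.$$ **Corollary.** Suppose that (i) there is a measure $\nu$ on $\mathbb R$ such that for every $\mathbf x$ the distribution $F(\cdot|\mathbf x)$ has a density $f(y|\mathbf x)$ with respect to $\nu$ that is measurable in $y$; (ii) $\beta\mapsto P\log p_\beta$ has a unique maximizer $\beta^*$ over $\mathcal B$, and the matrix $A(\beta^*)$ is nonsingular; (iii) $\beta^*$ is an interior point of $\mathcal B$. Then $C(\beta^*)$ is positive semidefinite and, as $n\to\infty$, $$\sqrt n\,(\hat\beta_n-\beta^*)\to\mathcal N(0_d,C(\beta^*))\quad\text{in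 distribution.}$$ -/

import Mathlib

open MeasureTheory ProbabilityTheory Filter Topology
open scoped ENNReal

noncomputable section

namespace LDPQuantile

/-- The constants of the protocol and of the model: total privacy budget `ε`, quantile level `α`,
scale `σ` of the asymmetric Laplace model, and truncation interval `[lo, hi]` for the response. -/
structure Params where
  (ε α σ lo hi : ℝ)
  ε_pos : 0 < ε
  α_pos : 0 < α
  α_lt_one : α < 1
  σ_pos : 0 < σ
  lo_lt_hi : lo < hi

/-- Truncation of a real number to the interval `[l, u]`. -/
def trunc (l u v : ℝ) : ℝ := max l (min u v)

/-- `C_ε = (e^ε + 1) / (e^ε - 1)`. -/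
def flipConst (ε : ℝ) : ℝ := (Real.exp ε + 1) / (Real.exp ε - 1)

/-- The bit flip with budget `ε` on `[l, u]`: the probability of the output bit `b`
(`true` is `z₊`, `false` is `z₋`) on input `v ∈ [l, u]`. -/
def bitFlip (ε l u : ℝ) (b : Bool) (v : ℝ) : ℝ :=
  match b with
  | true => 1 / 2 + (v - (u + l) / 2) / ((u - l) * flipConst ε)
  | false => 1 / 2 - (v - (u + l) / 2) / ((u - l) * flipConst ε)

/-- The check loss `ρ_α`. -/
def checkLoss (α τ : ℝ) : ℝ := if τ ≤ 0 then (α - 1) * τ else α * τ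

/-- What one user submits: the privatized covariates, an element of `{±1}^d`
(`true` stands for `+1`), and the privatized response bit (`true` stands for `1`). -/
abbrev Obs (d : ℕ) : Type := (Fin d → Bool) × Bool

/-- The vertex of the cube `{±1}^d` encoded by a vector of bits. -/
def vertex {d : ℕ} (s : Fin d → Bool) : EuclideanSpace ℝ (Fin d) :=
  WithLp.toLp 2 fun j => if s j then 1 else -1

namespace Params

variable (p : Params) {d : ℕ}

/-- The budget `ε' = ε / (d + 1)` spent on each covariate and on the response. -/
def budget (d : ℕ) : ℝ := p.ε / (d + 1)

/-- `Q(z | x)`: each covariate is truncated to `[-1, 1]` and bit-flipped, independently. -/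
def privX (z : Fin d → Bool) (x : EuclideanSpace ℝ (Fin d)) : ℝ :=
  ∏ j, bitFlip (p.budget d) (-1) 1 (z j) (trunc (-1) 1 (x j))

/-- `Q(b | y)`: the response is truncated to `[lo, hi]` and bit-flipped. -/
def privY (d : ℕ) (b : Bool) (y : ℝ) : ℝ :=
  bitFlip (p.budget d) p.lo p.hi b (trunc p.lo p.hi y)

/-- The true probability of a submission `(z, b)` when the covariates have law `FX` and the
response has conditional law `F x`. -/
def trueProb (FX : Measure (EuclideanSpace ℝ (Fin d))) (F : Kernel (EuclideanSpace ℝ (Fin d)) ℝ)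
    (o : Obs d) : ℝ :=
  ∫ x, ∫ y, p.privX o.1 x * p.privY d o.2 y ∂(F x) ∂FX

/-- The model density `f_β(y | x)`: asymmetric Laplace with location `⟨β, x⟩`. -/
def modelDensity (β x : EuclideanSpace ℝ (Fin d)) (y : ℝ) : ℝ :=
  p.α * (1 - p.α) / p.σ * Real.exp (-checkLoss p.α ((y - inner ℝ β x) / p.σ))

/-- `Λ(β, x)`: the model probability that the privatized response is `1`, given covariates `x`. -/
def lam (β x : EuclideanSpace ℝ (Fin d)) : ℝ :=
  ∫ y, p.privY d true y * p.modelDensity β x y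

/-- `p̂(z)`: the probability of `z` when the covariates have the uniform prior on `{±1}^d`. -/
def priorProb (z : Fin d → Bool) : ℝ :=
  (1 / 2 ^ d) * ∑ s : Fin d → Bool, p.privX z (vertex s)

/-- `Φ(β, z)`: the model probability that the privatized response is `1`, given the privatized
covariates `z`, under the uniform prior on `{±1}^d`. -/
def phi (β : EuclideanSpace ℝ (Fin d)) (z : Fin d → Bool) : ℝ :=
  ((1 / 2 ^ d) * ∑ s : Fin d → Bool, p.lam β (vertex s) * p.privX z (vertex s)) / p.priorProb z

/-- `log p_β(z, b)`, the log of the model probability of the submission `(z, b)`. -/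
def logModel (o : Obs d) (β : EuclideanSpace ℝ (Fin d)) : ℝ :=
  Real.log (p.priorProb o.1) + Real.log (if o.2 then p.phi β o.1 else 1 - p.phi β o.1)

/-- The log-likelihood `ℓ(β; D_n)` of the submissions `D 0, …, D (n - 1)`. -/
def logLik (n : ℕ) (D : ℕ → Obs d) (β : EuclideanSpace ℝ (Fin d)) : ℝ :=
  (1 / n) * ∑ i ∈ Finset.range n, p.logModel (D i) β

/-- `b` is a quasi-maximum likelihood estimate over the parameter set `Β`. -/
def IsQMLE (Β : Set (EuclideanSpace ℝ (Fin d))) (n : ℕ) (D : ℕ → Obs d)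
    (b : EuclideanSpace ℝ (Fin d)) : Prop :=
  b ∈ Β ∧ ∀ β ∈ Β, p.logLik n D β ≤ p.logLik n D b

variable (FX : Measure (EuclideanSpace ℝ (Fin d))) (F : Kernel (EuclideanSpace ℝ (Fin d)) ℝ)

/-- The expected log-likelihood `P log p_β`. -/
def expLogLik (β : EuclideanSpace ℝ (Fin d)) : ℝ :=
  ∑ o : Obs d, p.trueProb FX F o * p.logModel o β

/-- `∂ log p_β(o) / ∂β_j`. -/
def score (o : Obs d) (j : Fin d) (β : EuclideanSpace ℝ (Fin d)) : ℝ :=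
  fderiv ℝ (p.logModel o) β (EuclideanSpace.single j 1)

/-- `A(β) = P ∂² log p_β / ∂β²`. -/
def matA (β : EuclideanSpace ℝ (Fin d)) : Matrix (Fin d) (Fin d) ℝ :=
  Matrix.of fun j k => ∑ o : Obs d, p.trueProb FX F o *
    fderiv ℝ (p.score o k) β (EuclideanSpace.single j 1)

/-- `B(β) = P (∂ log p_β / ∂β) (∂ log p_β / ∂β)ᵀ`. -/
def matB (β : EuclideanSpace ℝ (Fin d)) : Matrix (Fin d) (Fin d) ℝ :=
  Matrix.of fun j k => ∑ o : Obs d, p.trueProb FX F o * (p.score o j β * p.score o k β)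

/-- `C(β) = A(β)⁻¹ B(β) A(β)⁻¹`. -/
def matC (β : EuclideanSpace ℝ (Fin d)) : Matrix (Fin d) (Fin d) ℝ :=
  (p.matA FX F β)⁻¹ * p.matB FX F β * (p.matA FX F β)⁻¹

end Params

end LDPQuantile

end

/-!
A submission takes only finitely many values, so the log-likelihood is a weighted sum of the
finitely many functions `β ↦ log p_β(o)`, the weights being the empirical frequencies. By
the strong law of large numbers these weights converge almost surely to the true probabilities.
Everything except the central limit theorem can then be done for a fixed sequence of observations.

*Smoothness.* `Λ(β, x)` is the convolution of the bounded continuous function `Q(1 | ·)` with a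
two-sided exponential density, evaluated at `⟨β, x⟩`. The density has a kink, but such a convolution
is still twice continuously differentiable (`contDiff_two_integral_mul_twoSidedExp`). The bit flips
have probabilities bounded away from `0` and `1`, so `0 < Φ < 1` and `log p_β(o)` is also `C²` in
`β` (`LDPQuantile.Params.contDiff_logModel`).

*Consistency.* On a compact set, maximizers of a sum with converging weights converge to the unique
maximizer of the limit (`tendsto_of_isMaxOn_of_tendsto_weights`).

*Linearization.* Since `β*` is interior, the estimator eventually solves the likelihood equation.
Expanding the score at `β*` shows that `β̂ₙ - β*` is asymptotically equivalent to the average of the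
influence vectors `-A(β*)⁻¹ ∂ log p_β*(zᵢ, bᵢ) / ∂β` (`isEquivalent_of_estimatingEquation`,
`LDPQuantile.Params.isEquivalent_of_isQMLE`).

*Limit law.* The influence vectors are independent, bounded and centred, and their second moment
matrix is `C(β*)` because `A(β*)` is symmetric (`LDPQuantile.Params.matC_eq_sum`). The multivariate
central limit theorem (`tendstoInDistribution_inv_sqrt_smul_sum`) gives the limit of their
normalized sums, and an almost sure asymptotic equivalence transfers it to the estimator
(`TendstoInDistribution.of_ae_isEquivalent`).
-/

/-! ### Asymptotic equivalence, the central limit theorem, and frequencies -/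

namespace MeasureTheory

/-- If `Y n - X n = o(X n)` almost surely, then `Y n` inherits the limit in distribution of `X n`.
This is Slutsky's theorem for `x + ‖x‖ • v` and the relative errors `v = ‖X n‖⁻¹ • (Y n - X n)`,
which tend to zero almost surely, so that no tightness argument is needed. -/
theorem TendstoInDistribution.of_ae_isEquivalent {Ω Ω' E : Type*} [MeasurableSpace Ω]
    [MeasurableSpace Ω'] {μ : Measure Ω} [IsProbabilityMeasure μ] {μ' : Measure Ω'}
    [IsProbabilityMeasure μ'] [NormedAddCommGroup E] [NormedSpace ℝ E] [MeasurableSpace E]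
    [BorelSpace E] [SecondCountableTopology E] {X Y : ℕ → Ω → E} {Z : Ω' → E}
    (hX : TendstoInDistribution X atTop Z (fun _ => μ) μ') (hY : ∀ n, AEMeasurable (Y n) μ)
    (hYX : ∀ᵐ ω ∂μ, Asymptotics.IsEquivalent atTop (fun n => Y n ω) (fun n => X n ω)) :
    TendstoInDistribution Y atTop Z (fun _ => μ) μ' := by
  have hXm := hX.forall_aemeasurable
  set V : ℕ → Ω → E := fun n ω => ‖X n ω‖⁻¹ • (Y n ω - X n ω) with hV
  have hVm : ∀ n, AEMeasurable (V n) μ := fun n =>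
    ((hXm n).norm.inv).smul ((hY n).sub (hXm n))
  have hV0 : TendstoInMeasure μ V atTop (fun _ => (0 : E)) := by
    refine tendstoInMeasure_of_tendsto_ae (fun n => (hVm n).aestronglyMeasurable) ?_
    filter_upwards [hYX] with ω hω
    refine tendsto_zero_iff_norm_tendsto_zero.2 ?_
    have h := hω.isLittleO.norm_norm.tendsto_div_nhds_zero
    refine h.congr fun n => ?_
    simp [hV, norm_smul, div_eq_inv_mul]
  have hS := hX.continuous_comp_prodMk_of_tendstoInMeasure_const
    (g := fun q : E × E => q.1 + ‖q.1‖ • q.2) (by fun_prop) hV0 hVm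
  simp only [smul_zero, add_zero] at hS
  refine tendstoInDistribution_of_tendstoInMeasure_sub Y Z hS ?_ hY
  refine tendstoInMeasure_of_tendsto_ae (fun n => ?_) ?_
  · exact ((hY n).sub ((hXm n).add ((hXm n).norm.smul (hVm n)))).aestronglyMeasurable
  · filter_upwards [hYX] with ω hω
    refine tendsto_const_nhds.congr' ?_
    -- Where `X n ω` vanishes, `V n ω` carries no information; there `Y n ω` vanishes eventually.
    filter_upwards [hω.isLittleO.bound one_pos] with n hn
    simp only [Pi.sub_apply, Pi.zero_apply, hV]
    by_cases h0 : X n ω = 0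
    · have : Y n ω = 0 := by simpa [h0] using hn
      simp [h0, this]
    · rw [smul_inv_smul₀ (norm_ne_zero_iff.2 h0)]
      abel

end MeasureTheory

/-- The relative frequency of `o` among the first `n` terms of `D` (zero for `n = 0`). -/
noncomputable def frequency {O : Type*} [DecidableEq O] (D : ℕ → O) (n : ℕ) (o : O) : ℝ :=
  (∑ i ∈ Finset.range n, if D i = o then (1 : ℝ) else 0) / n

theorem sum_frequency_smul {O E : Type*} [Fintype O] [DecidableEq O] [AddCommGroup E] [Module ℝ E]
    (D : ℕ → O) (n : ℕ) (g : O → E) :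
    ∑ o, frequency D n o • g o = (1 / n : ℝ) • ∑ i ∈ Finset.range n, g (D i) := by
  simp only [frequency, div_eq_inv_mul, mul_one, mul_smul, ← Finset.smul_sum, Finset.sum_smul]
  rw [Finset.sum_comm]
  simp

namespace ProbabilityTheory

/-- Central limit theorem for independent, identically distributed, centred square-integrable random
vectors. By Lévy's continuity theorem it reduces to the one-dimensional theorem for the projections
onto each direction `t`. -/
theorem tendstoInDistribution_inv_sqrt_smul_sum {Ω ι : Type*} [Fintype ι] [DecidableEq ι]
    [MeasurableSpace Ω] {μ : Measure Ω} [IsProbabilityMeasure μ]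
    {X : ℕ → Ω → EuclideanSpace ℝ ι} (hindep : iIndepFun X μ)
    (hident : ∀ i, IdentDistrib (X i) (X 0) μ μ) (hL2 : MemLp (X 0) 2 μ)
    {S : Matrix ι ι ℝ} (hS : S.PosSemidef)
    (hmean : ∀ t : EuclideanSpace ℝ ι, ∫ ω, inner ℝ t (X 0 ω) ∂μ = 0)
    (hcov : ∀ t : EuclideanSpace ℝ ι, ∫ ω, inner ℝ t (X 0 ω) ^ 2 ∂μ = t ⬝ᵥ S.mulVec t) :
    TendstoInDistribution (fun (n : ℕ) ω => (√(n : ℝ))⁻¹ • ∑ k ∈ Finset.range n, X k ω) atTop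
      (id : EuclideanSpace ℝ ι → EuclideanSpace ℝ ι) (fun _ => μ) (multivariateGaussian 0 S) := by
  have hXm : ∀ i, AEMeasurable (X i) μ := fun i => (hident i).aemeasurable_fst
  have hm : ∀ n : ℕ, AEMeasurable (fun ω => (√(n : ℝ))⁻¹ • ∑ k ∈ Finset.range n, X k ω) μ :=
    fun n => (measurable_const_smul _).comp_aemeasurable
      (Finset.aemeasurable_fun_sum _ fun i _ => hXm i)
  refine ⟨hm, aemeasurable_id, ProbabilityMeasure.tendsto_iff_tendsto_charFun.2 fun t => ?_⟩
  have hin : Measurable fun x : EuclideanSpace ℝ ι => inner ℝ t x := by fun_prop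
  have hv : Var[fun ω => inner ℝ t (X 0 ω); μ] = t ⬝ᵥ S.mulVec t := by
    exact (variance_of_integral_eq_zero (hin.comp_aemeasurable (hXm 0)) (hmean t)).trans (hcov t)
  have h1 := tendstoInDistribution_inv_sqrt_mul_sum_sub (P := μ)
    (P' := gaussianReal 0 Var[fun ω => inner ℝ t (X 0 ω); μ].toNNReal) (Y := id)
    (X := fun i ω => inner ℝ t (X i ω)) ⟨aemeasurable_id, Measure.map_id⟩
    (hL2.const_inner t) (hindep.comp (fun _ x => inner ℝ t x) fun _ => hin)
    (fun i => (hident i).comp hin)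
  have h2 := ProbabilityMeasure.tendsto_iff_tendsto_charFun.1 h1.tendsto 1
  simp only [ProbabilityMeasure.coe_mk, Measure.map_id] at h2 ⊢
  rw [charFun_multivariateGaussian hS]
  rw [charFun_gaussianReal, hv] at h2
  have hnn : 0 ≤ t ⬝ᵥ S.mulVec t := hv ▸ variance_nonneg _ _
  convert h2 using 2
  · rename_i n
    simp_rw [charFun_apply]
    rw [integral_map (hm n) (by fun_prop), integral_map (h1.forall_aemeasurable n) (by fun_prop)]
    refine integral_congr_ae (Eventually.of_forall fun ω => ?_)
    simp only [hmean t, mul_zero, sub_zero]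
    rw [real_inner_comm, inner_smul_right, inner_sum]
    simp
  · simp [Real.coe_toNNReal _ hnn]

theorem ae_tendsto_frequency {Ω O : Type*} [MeasurableSpace Ω] [MeasurableSpace O]
    [MeasurableSingletonClass O] [DecidableEq O] [Countable O] {μ : Measure Ω}
    [IsProbabilityMeasure μ]
    {D : ℕ → Ω → O} (hindep : iIndepFun D μ) (hident : ∀ i, IdentDistrib (D i) (D 0) μ μ) :
    ∀ᵐ ω ∂μ, ∀ o, Tendsto (fun n => frequency (fun i => D i ω) n o) atTop
      (𝓝 (μ.real (D 0 ⁻¹' {o}))) := by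
  refine ae_all_iff.2 fun o => ?_
  have hg : Measurable fun x : O => if x = o then (1 : ℝ) else 0 :=
    Measurable.ite (measurableSet_singleton o) measurable_const measurable_const
  have hae : AEMeasurable (D 0) μ := (hident 0).aemeasurable_fst
  have hb : Integrable (fun ω => if D 0 ω = o then (1 : ℝ) else 0) μ := by
    refine Integrable.of_bound (hg.comp_aemeasurable hae).aestronglyMeasurable 1
      (ae_of_all _ fun ω => ?_)
    split_ifs <;> simp
  have h := strong_law_ae_real (μ := μ) (fun i ω => if D i ω = o then (1 : ℝ) else 0) hb
    (fun i j hij => (hindep.indepFun hij).comp hg hg)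
    (fun i => (hident i).comp hg)
  have he : ∫ ω, (if D 0 ω = o then (1 : ℝ) else 0) ∂μ = μ.real (D 0 ⁻¹' {o}) := by
    have hn : NullMeasurableSet (D 0 ⁻¹' {o}) μ :=
      hae.nullMeasurableSet_preimage (measurableSet_singleton o)
    calc _ = ∫ ω, (D 0 ⁻¹' {o}).indicator (fun _ => (1 : ℝ)) ω ∂μ := by
          refine integral_congr_ae (ae_of_all _ fun ω => ?_)
          by_cases hω : D 0 ω = o <;> simp [hω]
      _ = _ := by simp [integral_indicator₀ hn]
  rw [he] at h
  exact h

end ProbabilityTheory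

/-! ### M-estimation from finitely many observations -/

open Asymptotics in
/-- Linearization of an estimating equation. If `b n → b₀` solves `∑ o, W n o • g o (b n) = 0` with
weights `W n → w`, and `S` is a left inverse of the derivative `∑ o, w o • H o` of the limiting
equation, then `b n - b₀` is asymptotically equivalent to `-S (∑ o, W n o • g o b₀)`. The proof
bounds the difference by `o(b n - b₀)`, which suffices since asymptotic equivalence is symmetric. -/
theorem isEquivalent_of_estimatingEquation {O E : Type*} [Fintype O] [NormedAddCommGroup E]
    [NormedSpace ℝ E] {g : O → E → E} {H : O → E →L[ℝ] E} {b₀ : E}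
    (hg : ∀ o, HasFDerivAt (g o) (H o) b₀) {w : O → ℝ} {S : E →L[ℝ] E}
    (hS : ∀ v, S (∑ o, w o • H o v) = v) {W : ℕ → O → ℝ}
    (hW : ∀ o, Tendsto (fun n => W n o) atTop (𝓝 (w o))) {b : ℕ → E}
    (hb : Tendsto b atTop (𝓝 b₀)) (h0 : ∀ᶠ n in atTop, ∑ o, W n o • g o (b n) = 0) :
    (fun n => b n - b₀) ~[atTop] fun n => ∑ o, W n o • -S (g o b₀) := by
  -- Replacing `g o (b n)` by its linearization and `W n o` by its limit changes each increment by
  -- only `o(b n - b₀)`.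
  have h1 : ∀ o, (fun n => W n o • (g o (b n) - g o b₀) - w o • H o (b n - b₀))
      =o[atTop] fun n => b n - b₀ := by
    intro o
    have hd : (fun n => g o (b n) - g o b₀ - H o (b n - b₀)) =o[atTop] fun n => b n - b₀ :=
      (hg o).isLittleO.comp_tendsto hb
    have hWb : (fun n => W n o) =O[atTop] fun _ => (1 : ℝ) := (hW o).isBigO_one ℝ
    have hWd : (fun n => W n o - w o) =o[atTop] fun _ => (1 : ℝ) := by
      rw [isLittleO_one_iff]
      simpa using (hW o).sub_const (w o)
    have hH : (fun n => H o (b n - b₀)) =O[atTop] fun n => b n - b₀ := (H o).isBigO_comp _ _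
    have e1 := hWb.smul_isLittleO hd
    have e2 := hWd.smul_isBigO hH
    simp only [one_smul] at e1 e2
    refine (e1.add e2).congr_left fun n => ?_
    module
  have h2 : (fun n => S (∑ o, (W n o • (g o (b n) - g o b₀) - w o • H o (b n - b₀))))
      =o[atTop] fun n => b n - b₀ :=
    (S.isBigO_comp _ _).trans_isLittleO (IsLittleO.fun_sum fun o _ => h1 o)
  have h3 : (fun n => ∑ o, W n o • -S (g o b₀)) ~[atTop] fun n => b n - b₀ := by
    refine IsLittleO.isEquivalent ?_
    refine h2.congr' ?_ EventuallyEq.rfl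
    filter_upwards [h0] with n hn
    simp only [smul_sub, Finset.sum_sub_distrib, hn, zero_sub, map_sub, map_neg, hS, map_sum,
      map_smul, smul_neg, Finset.sum_neg_distrib, Pi.sub_apply]
  exact h3.symm

/-- Consistency of maximizers over a compact set: if the weights `W n` tend to `w` and `b₀` is the
only maximizer for the weights `w`, then maximizers `b n` for the weights `W n` tend to `b₀`. By
compactness it is enough to exclude every other cluster point, at which joint continuity in weights
and parameter would contradict the maximality of `b n`. -/
theorem tendsto_of_isMaxOn_of_tendsto_weights {O X : Type*} [Fintype O] [TopologicalSpace X]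
    {K : Set X} (hK : IsCompact K) {ℓ : O → X → ℝ} (hℓ : ∀ o, Continuous (ℓ o)) {b₀ : X}
    (hb₀ : b₀ ∈ K) {w : O → ℝ} (hmax : ∀ x ∈ K, x ≠ b₀ → ∑ o, w o * ℓ o x < ∑ o, w o * ℓ o b₀)
    {W : ℕ → O → ℝ} (hW : ∀ o, Tendsto (fun n => W n o) atTop (𝓝 (w o))) {b : ℕ → X}
    (hbK : ∀ n, b n ∈ K) (hb : ∀ n, ∀ x ∈ K, ∑ o, W n o * ℓ o x ≤ ∑ o, W n o * ℓ o (b n)) :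
    Tendsto b atTop (𝓝 b₀) := by
  refine hK.tendsto_nhds_of_unique_mapClusterPt (Eventually.of_forall hbK) fun x hx hcl => ?_
  by_contra hne
  have hlt := hmax x hx hne
  have hc : Continuous fun q : (O → ℝ) × X => ∑ o, q.1 o * ℓ o q.2 - ∑ o, q.1 o * ℓ o b₀ := by
    fun_prop
  have hev := (hc.tendsto (w, x)).eventually_lt_const (sub_neg.2 hlt)
  rw [nhds_prod_eq, eventually_prod_iff] at hev
  obtain ⟨pa, hpa, pb, hpb, hab⟩ := hev
  have hWt : Tendsto W atTop (𝓝 w) := tendsto_pi_nhds.2 hW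
  obtain ⟨n, hn1, hn2⟩ := ((hcl.frequently hpb).and_eventually (hWt.eventually hpa)).exists
  have := hab hn2 hn1
  have := hb n b₀ hb₀
  simp only at *
  linarith

/-! ### Convolution with a two-sided exponential -/

section TwoSidedExp

open Real Set

theorem hasDerivAt_integral_Iic {f : ℝ → ℝ} (hf : Continuous f)
    (hint : ∀ m, IntegrableOn f (Iic m)) (m : ℝ) :
    HasDerivAt (fun m => ∫ y in Iic m, f y) (f m) m := by
  have h : (fun m => ∫ y in Iic m, f y) = fun m =>
      (∫ y in (0 : ℝ)..m, f y) + ∫ y in Iic 0, f y := by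
    funext m
    rw [← intervalIntegral.integral_Iic_sub_Iic (hint 0) (hint m), sub_add_cancel]
  rw [h]
  exact (hf.integral_hasStrictDerivAt 0 m).hasDerivAt.add_const _

theorem hasDerivAt_integral_Ioi {f : ℝ → ℝ} (hf : Continuous f)
    (hint : ∀ m, IntegrableOn f (Ioi m)) (m : ℝ) :
    HasDerivAt (fun m => ∫ y in Ioi m, f y) (-f m) m := by
  have h : (fun m => ∫ y in Ioi m, f y) = fun m =>
      (∫ y in Ioi 0, f y) - ∫ y in (0 : ℝ)..m, f y := by
    funext m
    rw [← intervalIntegral.integral_Ioi_sub_Ioi' (hint 0) (hint m), sub_sub_cancel]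
  rw [h]
  exact (hf.integral_hasStrictDerivAt 0 m).hasDerivAt.const_sub _

/-- The two-sided exponential kernel with left rate `a` and right rate `b`. -/
noncomputable def twoSidedExp (a b t : ℝ) : ℝ := if t ≤ 0 then exp (a * t) else exp (-b * t)

variable {a b : ℝ} {h : ℝ → ℝ} {M : ℝ}

theorem integrableOn_Iic_mul_exp (ha : 0 < a) (hh : Continuous h) (hM : ∀ y, |h y| ≤ M) (m : ℝ) :
    IntegrableOn (fun y => h y * exp (a * y)) (Iic m) :=
  (integrableOn_exp_mul_Iic ha m).bdd_mul hh.aestronglyMeasurable (ae_of_all _ hM)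

theorem integrableOn_Ioi_mul_exp (hb : 0 < b) (hh : Continuous h) (hM : ∀ y, |h y| ≤ M) (m : ℝ) :
    IntegrableOn (fun y => h y * exp (-b * y)) (Ioi m) :=
  (integrableOn_exp_mul_Ioi (neg_neg_iff_pos.2 hb) m).bdd_mul hh.aestronglyMeasurable
    (ae_of_all _ hM)

theorem mul_twoSidedExp_eqOn_Iic (a b m : ℝ) (h : ℝ → ℝ) :
    EqOn (fun y => h y * twoSidedExp a b (y - m))
      (fun y => exp (-a * m) * (h y * exp (a * y))) (Iic m) := fun y hy => by
  have hy' : y - m ≤ 0 := sub_nonpos.2 hy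
  simp only [twoSidedExp, if_pos hy']
  rw [mul_left_comm, ← exp_add]
  ring_nf

theorem mul_twoSidedExp_eqOn_Ioi (a b m : ℝ) (h : ℝ → ℝ) :
    EqOn (fun y => h y * twoSidedExp a b (y - m))
      (fun y => exp (b * m) * (h y * exp (-b * y))) (Ioi m) := fun y hy => by
  have hy' : ¬ y - m ≤ 0 := not_le.2 (sub_pos.2 hy)
  simp only [twoSidedExp, if_neg hy']
  rw [mul_left_comm, ← exp_add]
  ring_nf

theorem integrable_mul_twoSidedExp (ha : 0 < a) (hb : 0 < b) (hh : Continuous h)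
    (hM : ∀ y, |h y| ≤ M) (m : ℝ) : Integrable fun y => h y * twoSidedExp a b (y - m) := by
  rw [← integrableOn_univ, ← Iic_union_Ioi (a := m)]
  refine IntegrableOn.union ?_ ?_
  · exact IntegrableOn.congr_fun ((integrableOn_Iic_mul_exp ha hh hM m).const_mul _)
      (mul_twoSidedExp_eqOn_Iic a b m h).symm measurableSet_Iic
  · exact IntegrableOn.congr_fun ((integrableOn_Ioi_mul_exp hb hh hM m).const_mul _)
      (mul_twoSidedExp_eqOn_Ioi a b m h).symm measurableSet_Ioi

theorem integral_mul_twoSidedExp (ha : 0 < a) (hb : 0 < b) (hh : Continuous h)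
    (hM : ∀ y, |h y| ≤ M) (m : ℝ) :
    ∫ y, h y * twoSidedExp a b (y - m) = exp (-a * m) * (∫ y in Iic m, h y * exp (a * y)) +
      exp (b * m) * ∫ y in Ioi m, h y * exp (-b * y) := by
  have hint := integrable_mul_twoSidedExp ha hb hh hM m
  rw [← intervalIntegral.integral_Iic_add_Ioi (b := m) hint.integrableOn hint.integrableOn,
    setIntegral_congr_fun measurableSet_Iic (mul_twoSidedExp_eqOn_Iic a b m h),
    setIntegral_congr_fun measurableSet_Ioi (mul_twoSidedExp_eqOn_Ioi a b m h),
    integral_const_mul, integral_const_mul]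

theorem integral_twoSidedExp (ha : 0 < a) (hb : 0 < b) (m : ℝ) :
    ∫ y, twoSidedExp a b (y - m) = 1 / a + 1 / b := by
  have h := integral_mul_twoSidedExp ha hb (h := fun _ => 1) (M := 1) continuous_const (by simp) m
  simp only [one_mul] at h
  rw [h, integral_exp_mul_Iic ha, integral_exp_mul_Ioi (neg_neg_iff_pos.2 hb), mul_div_assoc',
    ← exp_add, neg_div_neg_eq, mul_div_assoc', ← exp_add]
  simp

/-- Convolving with the two-sided exponential gains two derivatives: the boundary terms produced by
differentiating the two half-line integrals cancel, because the kernel is continuous at its kink,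
so the first derivative is again a combination of these two integrals. -/
theorem contDiff_two_integral_mul_twoSidedExp (ha : 0 < a) (hb : 0 < b) (hh : Continuous h)
    (hM : ∀ y, |h y| ≤ M) : ContDiff ℝ 2 fun m => ∫ y, h y * twoSidedExp a b (y - m) := by
  set U : ℝ → ℝ := fun m => exp (-a * m) * ∫ y in Iic m, h y * exp (a * y) with hU
  set V : ℝ → ℝ := fun m => exp (b * m) * ∫ y in Ioi m, h y * exp (-b * y) with hV
  have hL : (fun m => ∫ y, h y * twoSidedExp a b (y - m)) = fun m => U m + V m :=
    funext fun m => integral_mul_twoSidedExp ha hb hh hM m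
  have dU : ∀ m, HasDerivAt U (-a * U m + h m) m := by
    intro m
    have e : HasDerivAt (fun m : ℝ => exp (-a * m)) (exp (-a * m) * (-a)) m := by
      simpa using ((hasDerivAt_id m).const_mul (-a)).exp
    have e2 := e.mul (hasDerivAt_integral_Iic (f := fun y => h y * exp (a * y)) (by fun_prop)
      (integrableOn_Iic_mul_exp ha hh hM) m)
    refine e2.congr_deriv ?_
    have : exp (-a * m) * exp (a * m) = 1 := by rw [← exp_add]; simp
    simp only [hU]
    linear_combination h m * this
  have dV : ∀ m, HasDerivAt V (b * V m - h m) m := by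
    intro m
    have e : HasDerivAt (fun m : ℝ => exp (b * m)) (exp (b * m) * b) m := by
      simpa using ((hasDerivAt_id m).const_mul b).exp
    have e2 := e.mul (hasDerivAt_integral_Ioi (f := fun y => h y * exp (-b * y)) (by fun_prop)
      (integrableOn_Ioi_mul_exp hb hh hM) m)
    refine e2.congr_deriv ?_
    have : exp (b * m) * exp (-b * m) = 1 := by rw [← exp_add]; simp
    simp only [hV]
    linear_combination - h m * this
  have cU : ContDiff ℝ 1 U := by
    refine contDiff_one_iff_deriv.2 ⟨fun m => (dU m).differentiableAt, ?_⟩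
    rw [show deriv U = fun m => -a * U m + h m from funext fun m => (dU m).deriv]
    have : Continuous U := continuous_iff_continuousAt.2 fun m => (dU m).continuousAt
    fun_prop
  have cV : ContDiff ℝ 1 V := by
    refine contDiff_one_iff_deriv.2 ⟨fun m => (dV m).differentiableAt, ?_⟩
    rw [show deriv V = fun m => b * V m - h m from funext fun m => (dV m).deriv]
    have : Continuous V := continuous_iff_continuousAt.2 fun m => (dV m).continuousAt
    fun_prop
  have dL : ∀ m, HasDerivAt (fun m => U m + V m) (-a * U m + b * V m) m := fun m =>
    ((dU m).add (dV m)).congr_deriv (by ring)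
  rw [hL, show (2 : WithTop ℕ∞) = 1 + 1 from one_add_one_eq_two.symm, contDiff_succ_iff_deriv]
  refine ⟨fun m => (dL m).differentiableAt, by simp, ?_⟩
  rw [show deriv (fun m => U m + V m) = fun m => -a * U m + b * V m from
    funext fun m => (dL m).deriv]
  fun_prop

end TwoSidedExp

/-! ### Smoothness and non-degeneracy of the privatized model -/

namespace LDPQuantile

theorem one_lt_flipConst {ε : ℝ} (hε : 0 < ε) : 1 < flipConst ε := by
  have := Real.add_one_lt_exp hε.ne'
  rw [flipConst, one_lt_div (by linarith)]
  linarith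

theorem trunc_mem_Icc {l u : ℝ} (hlu : l ≤ u) (v : ℝ) : trunc l u v ∈ Set.Icc l u :=
  ⟨le_max_left _ _, max_le hlu (min_le_left _ _)⟩

theorem continuous_trunc (l u : ℝ) : Continuous (trunc l u) :=
  continuous_const.max (continuous_const.min continuous_id)

theorem bitFlip_mem_Icc {ε l u v : ℝ} (hε : 0 < ε) (hlu : l < u) (hv : v ∈ Set.Icc l u) (b : Bool) :
    bitFlip ε l u b v ∈ Set.Icc ((1 - 1 / flipConst ε) / 2) (1 - (1 - 1 / flipConst ε) / 2) := by
  have hC : 0 < flipConst ε := one_pos.trans (one_lt_flipConst hε)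
  have hul : 0 < u - l := sub_pos.2 hlu
  have h : |(v - (u + l) / 2) / ((u - l) * flipConst ε)| ≤ 1 / flipConst ε / 2 := by
    rw [abs_div, abs_of_pos (mul_pos hul hC), div_le_iff₀ (mul_pos hul hC)]
    have : 1 / flipConst ε / 2 * ((u - l) * flipConst ε) = (u - l) / 2 := by
      field_simp
    rw [this, abs_le]
    constructor <;> linarith [hv.1, hv.2]
  obtain ⟨h1, h2⟩ := abs_le.1 h
  cases b <;> simp only [bitFlip, Set.mem_Icc] <;> constructor <;> linarith

namespace Params

variable (p : Params) {d : ℕ}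

theorem budget_pos (d : ℕ) : 0 < p.budget d := div_pos p.ε_pos (by positivity)

/-- The least probability with which a bit flip outputs a given bit. -/
noncomputable def flipMin (d : ℕ) : ℝ := (1 - 1 / flipConst (p.budget d)) / 2

theorem flipMin_pos (d : ℕ) : 0 < p.flipMin d := by
  have h := one_lt_flipConst (p.budget_pos d)
  have : 1 / flipConst (p.budget d) < 1 := (div_lt_one (one_pos.trans h)).2 h
  unfold flipMin
  linarith

theorem privX_pos (z : Fin d → Bool) (x : EuclideanSpace ℝ (Fin d)) : 0 < p.privX z x :=
  Finset.prod_pos fun j _ => (p.flipMin_pos d).trans_le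
    (bitFlip_mem_Icc (p.budget_pos d) (by norm_num) (trunc_mem_Icc (by norm_num) _) (z j)).1

theorem privY_mem_Icc (d : ℕ) (b : Bool) (y : ℝ) :
    p.privY d b y ∈ Set.Icc (p.flipMin d) (1 - p.flipMin d) :=
  bitFlip_mem_Icc (p.budget_pos d) p.lo_lt_hi (trunc_mem_Icc p.lo_lt_hi.le _) b

theorem continuous_privY_true (d : ℕ) : Continuous (p.privY d true) := by
  have := continuous_trunc p.lo p.hi
  unfold privY bitFlip
  fun_prop

theorem abs_privY_le (d : ℕ) (b : Bool) (y : ℝ) : |p.privY d b y| ≤ 1 := by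
  have h := p.privY_mem_Icc d b y
  have := p.flipMin_pos d
  rw [abs_le]
  constructor <;> linarith [h.1, h.2]

theorem leftRate_pos : 0 < (1 - p.α) / p.σ := div_pos (sub_pos.2 p.α_lt_one) p.σ_pos

theorem rightRate_pos : 0 < p.α / p.σ := div_pos p.α_pos p.σ_pos

theorem modelDensity_eq (β x : EuclideanSpace ℝ (Fin d)) (y : ℝ) :
    p.modelDensity β x y = p.α * (1 - p.α) / p.σ *
      twoSidedExp ((1 - p.α) / p.σ) (p.α / p.σ) (y - inner ℝ β x) := by
  have hiff : (y - inner ℝ β x) / p.σ ≤ 0 ↔ y - inner ℝ β x ≤ 0 := by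
    rw [div_le_iff₀ p.σ_pos, zero_mul]
  simp only [modelDensity, checkLoss, twoSidedExp, hiff]
  split_ifs <;> ring_nf

theorem modelDensity_nonneg (β x : EuclideanSpace ℝ (Fin d)) (y : ℝ) :
    0 ≤ p.modelDensity β x y := by
  have := p.α_pos
  have := sub_pos.2 p.α_lt_one
  have := p.σ_pos
  unfold modelDensity
  positivity

theorem integral_modelDensity (β x : EuclideanSpace ℝ (Fin d)) :
    ∫ y, p.modelDensity β x y = 1 := by
  have h1 := p.α_pos.ne'
  have h2 := (sub_pos.2 p.α_lt_one).ne'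
  have h3 := p.σ_pos.ne'
  simp_rw [modelDensity_eq, integral_const_mul,
    integral_twoSidedExp p.leftRate_pos p.rightRate_pos]
  field_simp
  ring

theorem integrable_mul_modelDensity {h : ℝ → ℝ} {M : ℝ} (hh : Continuous h)
    (hM : ∀ y, |h y| ≤ M) (β x : EuclideanSpace ℝ (Fin d)) :
    Integrable fun y => h y * p.modelDensity β x y := by
  simp only [modelDensity_eq, mul_left_comm (h _)]
  exact (integrable_mul_twoSidedExp p.leftRate_pos p.rightRate_pos hh hM _).const_mul _

theorem lam_mem_Icc (β x : EuclideanSpace ℝ (Fin d)) :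
    p.lam β x ∈ Set.Icc (p.flipMin d) (1 - p.flipMin d) := by
  have hint := p.integrable_mul_modelDensity (p.continuous_privY_true d) (p.abs_privY_le d true) β x
  have hc : ∀ c : ℝ, Integrable fun y => c * p.modelDensity β x y := fun c =>
    p.integrable_mul_modelDensity (h := fun _ => c) (M := |c|) continuous_const
      (fun _ => le_rfl) β x
  have hi : ∀ c : ℝ, ∫ y, c * p.modelDensity β x y = c := fun c => by
    rw [integral_const_mul, integral_modelDensity, mul_one]
  constructor
  · rw [← hi (p.flipMin d)]
    exact integral_mono (hc _) hint fun y =>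
      mul_le_mul_of_nonneg_right (p.privY_mem_Icc d true y).1 (p.modelDensity_nonneg β x y)
  · rw [← hi (1 - p.flipMin d)]
    exact integral_mono hint (hc _) fun y =>
      mul_le_mul_of_nonneg_right (p.privY_mem_Icc d true y).2 (p.modelDensity_nonneg β x y)

theorem contDiff_lam (x : EuclideanSpace ℝ (Fin d)) : ContDiff ℝ 2 fun β => p.lam β x := by
  have h := contDiff_two_integral_mul_twoSidedExp p.leftRate_pos p.rightRate_pos
    (p.continuous_privY_true d) (p.abs_privY_le d true)
  have h2 : ContDiff ℝ 2 fun β : EuclideanSpace ℝ (Fin d) => inner ℝ β x :=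
    contDiff_id.inner ℝ contDiff_const
  have he : (fun β => p.lam β x) = fun β => p.α * (1 - p.α) / p.σ * ∫ y, p.privY d true y *
      twoSidedExp ((1 - p.α) / p.σ) (p.α / p.σ) (y - inner ℝ β x) := by
    funext β
    simp only [lam, modelDensity_eq, ← integral_const_mul, mul_left_comm (p.privY d true _)]
  rw [he]
  exact contDiff_const.mul (h.comp h2)

theorem priorProb_pos (z : Fin d → Bool) : 0 < p.priorProb z :=
  mul_pos (by positivity) (Finset.sum_pos (fun s _ => p.privX_pos z _) Finset.univ_nonempty)

theorem phi_pos (β : EuclideanSpace ℝ (Fin d)) (z : Fin d → Bool) : 0 < p.phi β z :=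
  div_pos (mul_pos (by positivity) (Finset.sum_pos (fun s _ =>
    mul_pos ((p.flipMin_pos d).trans_le (p.lam_mem_Icc β _).1) (p.privX_pos z _))
    Finset.univ_nonempty)) (p.priorProb_pos z)

theorem phi_lt_one (β : EuclideanSpace ℝ (Fin d)) (z : Fin d → Bool) : p.phi β z < 1 := by
  rw [phi, div_lt_one (p.priorProb_pos z), priorProb]
  refine mul_lt_mul_of_pos_left (Finset.sum_lt_sum_of_nonempty Finset.univ_nonempty fun s _ => ?_)
    (by positivity)
  refine mul_lt_of_lt_one_left (p.privX_pos z _) ?_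
  linarith [(p.lam_mem_Icc β (vertex s)).2, p.flipMin_pos d]

theorem contDiff_phi (z : Fin d → Bool) : ContDiff ℝ 2 fun β => p.phi β z := by
  have := fun s : Fin d → Bool => p.contDiff_lam (vertex s)
  unfold phi
  fun_prop

theorem contDiff_logModel (o : Obs d) : ContDiff ℝ 2 (p.logModel o) := by
  have h := p.contDiff_phi o.1
  refine contDiff_const.add (ContDiff.log ?_ fun β => ?_)
  · split_ifs
    · exact h
    · exact contDiff_const.sub h
  · split_ifs
    · exact (p.phi_pos β _).ne'
    · exact (sub_pos.2 (p.phi_lt_one β _)).ne'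

end Params

end LDPQuantile

/-! ### Score, Hessian and limiting covariance -/

namespace LDPQuantile

namespace Params

variable (p : Params) {d : ℕ}

/-- The score `∂ log p_β(o) / ∂β` as a vector. -/
noncomputable def scoreVec (o : Obs d) (β : EuclideanSpace ℝ (Fin d)) : EuclideanSpace ℝ (Fin d) :=
  WithLp.toLp 2 fun j => p.score o j β

theorem contDiff_score (o : Obs d) (j : Fin d) : ContDiff ℝ 1 (p.score o j) :=
  ((p.contDiff_logModel o).fderiv_right (m := 1) (by norm_num)).clm_apply contDiff_const

theorem differentiable_scoreVec (o : Obs d) : Differentiable ℝ (p.scoreVec o) :=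
  differentiable_euclidean.2 fun j => (p.contDiff_score o j).differentiable one_ne_zero

theorem fderiv_scoreVec_apply (o : Obs d) (β v : EuclideanSpace ℝ (Fin d)) (j : Fin d) :
    fderiv ℝ (p.scoreVec o) β v j = fderiv ℝ (p.score o j) β v := by
  have h : HasFDerivAt (p.score o j) _ β :=
    (EuclideanSpace.proj (𝕜 := ℝ) j).hasFDerivAt.comp β (p.differentiable_scoreVec o β).hasFDerivAt
  rw [h.fderiv]
  rfl

theorem fderiv_score_comm (o : Obs d) (j k : Fin d) (β : EuclideanSpace ℝ (Fin d)) :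
    fderiv ℝ (p.score o k) β (EuclideanSpace.single j 1) =
      fderiv ℝ (p.score o j) β (EuclideanSpace.single k 1) := by
  have hd : DifferentiableAt ℝ (fderiv ℝ (p.logModel o)) β :=
    ((p.contDiff_logModel o).fderiv_right (m := 1) (by norm_num)).differentiable one_ne_zero β
  have hs := (p.contDiff_logModel o).contDiffAt (x := β).isSymmSndFDerivAt (by simp)
  have key : ∀ k v, fderiv ℝ (p.score o k) β v =
      fderiv ℝ (fderiv ℝ (p.logModel o)) β v (EuclideanSpace.single k 1) := fun k v => by
    unfold score
    rw [fderiv_clm_apply hd (by fun_prop)]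
    simp
  rw [key, key]
  exact hs.eq _ _

/-- The likelihood equation, for arbitrary weights on the observations. -/
theorem sum_smul_scoreVec_eq_zero {W : Obs d → ℝ} {β : EuclideanSpace ℝ (Fin d)}
    (h : IsLocalMax (fun β => ∑ o, W o * p.logModel o β) β) :
    ∑ o, W o • p.scoreVec o β = 0 := by
  have hd : ∀ o, DifferentiableAt ℝ (p.logModel o) β := fun o =>
    (p.contDiff_logModel o).differentiable two_ne_zero β
  have h0 := h.fderiv_eq_zero
  rw [fderiv_fun_sum fun o _ => (hd o).const_mul _] at h0
  ext j
  have := congrArg (fun L => L (EuclideanSpace.single j 1)) h0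
  simpa [fderiv_const_mul (hd _), scoreVec, score] using this

variable (FX : Measure (EuclideanSpace ℝ (Fin d))) (F : Kernel (EuclideanSpace ℝ (Fin d)) ℝ)

theorem transpose_matA (β : EuclideanSpace ℝ (Fin d)) :
    (p.matA FX F β).transpose = p.matA FX F β := by
  ext j k
  simp only [matA, Matrix.transpose_apply, Matrix.of_apply, p.fderiv_score_comm _ j k]

/-- The expected derivative of the score acts as the matrix `A(β)`. The derivative naturally gives
the transpose of `A(β)`; the two agree because second derivatives are symmetric. -/
theorem sum_smul_fderiv_scoreVec (β v : EuclideanSpace ℝ (Fin d)) :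
    ∑ o, p.trueProb FX F o • fderiv ℝ (p.scoreVec o) β v =
      WithLp.toLp 2 ((p.matA FX F β).mulVec v) := by
  ext k
  have hv : v = ∑ j, v j • EuclideanSpace.single j (1 : ℝ) := by
    ext i
    simp [Finset.sum_apply, Pi.single_apply]
  have hL : ∀ L : EuclideanSpace ℝ (Fin d) →L[ℝ] ℝ,
      L v = ∑ j, v j * L (EuclideanSpace.single j 1) := fun L => by
    conv_lhs => rw [hv]
    simp
  rw [← transpose_matA]
  simp only [WithLp.ofLp_sum, WithLp.ofLp_smul, Finset.sum_apply, Pi.smul_apply, smul_eq_mul,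
    fderiv_scoreVec_apply, hL, Matrix.mulVec, dotProduct, Matrix.transpose_apply, matA,
    Matrix.of_apply, Finset.mul_sum, Finset.sum_mul]
  rw [Finset.sum_comm]
  refine Finset.sum_congr rfl fun j _ => Finset.sum_congr rfl fun o _ => ?_
  ring

/-- The influence of the observation `o` on the estimator: minus the inverse Hessian of the expected
log-likelihood applied to the score. -/
noncomputable def influence (β : EuclideanSpace ℝ (Fin d)) (o : Obs d) : EuclideanSpace ℝ (Fin d) :=
  -Matrix.toEuclideanCLM (𝕜 := ℝ) (p.matA FX F β)⁻¹ (p.scoreVec o β)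

/-- The sandwich matrix is the second moment of the influence. -/
theorem matC_eq_sum (β : EuclideanSpace ℝ (Fin d)) :
    p.matC FX F β = ∑ o, p.trueProb FX F o •
      Matrix.vecMulVec (p.influence FX F β o).ofLp (p.influence FX F β o).ofLp := by
  have hB : p.matB FX F β = ∑ o, p.trueProb FX F o •
      Matrix.vecMulVec (p.scoreVec o β).ofLp (p.scoreVec o β).ofLp := by
    ext j k
    simp [matB, Matrix.sum_apply, Matrix.vecMulVec_apply, scoreVec]
  have hT : ∀ s : Fin d → ℝ, Matrix.vecMul s (p.matA FX F β)⁻¹ = (p.matA FX F β)⁻¹.mulVec s := by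
    intro s
    rw [← Matrix.mulVec_transpose, Matrix.transpose_nonsing_inv, transpose_matA]
  rw [matC, hB, Finset.mul_sum, Finset.sum_mul]
  refine Finset.sum_congr rfl fun o _ => ?_
  rw [Matrix.mul_smul, Matrix.smul_mul, Matrix.mul_vecMulVec, Matrix.vecMulVec_mul, hT]
  simp [influence, Matrix.ofLp_toEuclideanCLM, Matrix.neg_vecMulVec, Matrix.vecMulVec_neg]

theorem posSemidef_matC (hP : ∀ o, 0 ≤ p.trueProb FX F o) (β : EuclideanSpace ℝ (Fin d)) :
    (p.matC FX F β).PosSemidef := by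
  rw [matC_eq_sum]
  refine Matrix.posSemidef_sum _ fun o _ => Matrix.PosSemidef.smul ?_ (hP o)
  simpa using Matrix.posSemidef_vecMulVec_self_star (p.influence FX F β o).ofLp

theorem sum_mul_inner_influence_sq (β t : EuclideanSpace ℝ (Fin d)) :
    ∑ o, p.trueProb FX F o * inner ℝ t (p.influence FX F β o) ^ 2 =
      t ⬝ᵥ (p.matC FX F β).mulVec t := by
  rw [matC_eq_sum, Matrix.sum_mulVec, dotProduct_sum]
  refine Finset.sum_congr rfl fun o _ => ?_
  rw [Matrix.smul_mulVec, Matrix.vecMulVec_mulVec, dotProduct_smul]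
  simp [EuclideanSpace.inner_eq_star_dotProduct, dotProduct_comm t.ofLp]
  exact Or.inl (sq _)

theorem logLik_eq_sum (n : ℕ) (D : ℕ → Obs d) (β : EuclideanSpace ℝ (Fin d)) :
    p.logLik n D β = ∑ o, frequency D n o * p.logModel o β :=
  (sum_frequency_smul D n fun o => p.logModel o β).symm

variable {p FX F}

/-- Deterministic form of the asymptotic normality: along any sequence of observations whose
frequencies converge to the true probabilities, the error of the estimator is asymptotically
equivalent to the average influence. -/
theorem isEquivalent_of_isQMLE {Β : Set (EuclideanSpace ℝ (Fin d))} (hΒ : IsCompact Β)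
    {βs : EuclideanSpace ℝ (Fin d)} (hβs : βs ∈ interior Β)
    (hmax : ∀ β ∈ Β, β ≠ βs → p.expLogLik FX F β < p.expLogLik FX F βs)
    (hA : IsUnit (p.matA FX F βs).det) {D : ℕ → Obs d}
    (hD : ∀ o, Tendsto (fun n => frequency D n o) atTop (𝓝 (p.trueProb FX F o)))
    {b : ℕ → EuclideanSpace ℝ (Fin d)} (hb : ∀ n, p.IsQMLE Β n D (b n)) :
    Asymptotics.IsEquivalent atTop (fun n => b n - βs)
      fun n => (1 / n : ℝ) • ∑ i ∈ Finset.range n, p.influence FX F βs (D i) := by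
  have hlim : Tendsto b atTop (𝓝 βs) := by
    refine tendsto_of_isMaxOn_of_tendsto_weights hΒ
      (fun o => (p.contDiff_logModel o).continuous) (interior_subset hβs) hmax hD
      (fun n => (hb n).1) fun n β hβ => ?_
    simpa only [logLik_eq_sum] using (hb n).2 β hβ
  have hS : ∀ v, Matrix.toEuclideanCLM (𝕜 := ℝ) (p.matA FX F βs)⁻¹
      (∑ o, p.trueProb FX F o • fderiv ℝ (p.scoreVec o) βs v) = v := fun v => by
    rw [sum_smul_fderiv_scoreVec, Matrix.toEuclideanCLM_toLp, Matrix.mulVec_mulVec,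
      Matrix.nonsing_inv_mul _ hA, Matrix.one_mulVec]
  have h := isEquivalent_of_estimatingEquation
    (fun o => (p.differentiable_scoreVec o βs).hasFDerivAt) hS hD hlim ?_
  · simp only [← sum_frequency_smul]
    exact h
  · filter_upwards [hlim.eventually (isOpen_interior.mem_nhds hβs)] with n hn
    refine p.sum_smul_scoreVec_eq_zero ?_
    filter_upwards [mem_interior_iff_mem_nhds.1 hn] with β hβ
    simpa only [logLik_eq_sum] using (hb n).2 β hβ

/-- The influence is centred, because `βs` satisfies the likelihood equation for the true
probabilities. -/
theorem sum_smul_influence_eq_zero {Β : Set (EuclideanSpace ℝ (Fin d))}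
    {βs : EuclideanSpace ℝ (Fin d)} (hβs : βs ∈ interior Β)
    (hmax : ∀ β ∈ Β, β ≠ βs → p.expLogLik FX F β < p.expLogLik FX F βs) :
    ∑ o, p.trueProb FX F o • p.influence FX F βs o = 0 := by
  have h : ∑ o, p.trueProb FX F o • p.scoreVec o βs = 0 := by
    refine p.sum_smul_scoreVec_eq_zero ?_
    filter_upwards [mem_interior_iff_mem_nhds.1 hβs] with β hβ
    rcases eq_or_ne β βs with rfl | hne
    · exact le_rfl
    · exact (hmax β hβ hne).le
  simp only [influence, smul_neg, Finset.sum_neg_distrib, ← map_smul, ← map_sum, h, map_zero,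
    neg_zero]

end Params

end LDPQuantile

theorem mainTheorem6 {d : ℕ} (p : LDPQuantile.Params)
    -- the unknown true distribution: law of the covariates and conditional law of the response
    (FX : Measure (EuclideanSpace ℝ (Fin d))) [IsProbabilityMeasure FX]
    (F : Kernel (EuclideanSpace ℝ (Fin d)) ℝ) [IsMarkovKernel F]
    -- the conditional law has a density, measurable in the response
    (ν : Measure ℝ) (f : EuclideanSpace ℝ (Fin d) → ℝ → ℝ≥0∞)
    (hf : ∀ x, Measurable (f x)) (hF : ∀ x, F x = ν.withDensity (f x))
    -- the compact parameter set; the expected log-likelihood has a unique maximum, in the interior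
    (Β : Set (EuclideanSpace ℝ (Fin d))) (hΒ : IsCompact Β)
    (βs : EuclideanSpace ℝ (Fin d)) (hβs : βs ∈ interior Β)
    (hmax : ∀ β ∈ Β, β ≠ βs → p.expLogLik FX F β < p.expLogLik FX F βs)
    (hA : IsUnit (p.matA FX F βs).det)
    -- the submissions are independent with the law produced by the protocol
    {Ω : Type*} [MeasurableSpace Ω] (μ : Measure Ω) [IsProbabilityMeasure μ]
    (D : ℕ → Ω → LDPQuantile.Obs d) (hD : ∀ i, Measurable (D i)) (hindep : iIndepFun D μ)
    (hlaw : ∀ i o, μ.real (D i ⁻¹' {o}) = p.trueProb FX F o)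
    -- the estimator
    (βhat : ℕ → Ω → EuclideanSpace ℝ (Fin d)) (hmeas : ∀ n, AEMeasurable (βhat n) μ)
    (hβhat : ∀ n, ∀ᵐ ω ∂μ, p.IsQMLE Β n (fun i => D i ω) (βhat n ω)) :
    (p.matC FX F βs).PosSemidef ∧
      TendstoInDistribution (fun (n : ℕ) ω => √(n : ℝ) • (βhat n ω - βs)) atTop
        (id : EuclideanSpace ℝ (Fin d) → EuclideanSpace ℝ (Fin d)) (fun _ => μ)
        (multivariateGaussian 0 (p.matC FX F βs)) := by
  have hC : (p.matC FX F βs).PosSemidef :=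
    p.posSemidef_matC FX F (fun o => hlaw 0 o ▸ measureReal_nonneg) βs
  refine ⟨hC, ?_⟩
  have hident : ∀ i, IdentDistrib (D i) (D 0) μ μ := fun i =>
    ⟨(hD i).aemeasurable, (hD 0).aemeasurable, Measure.ext_of_singleton fun o => by
      rw [Measure.map_apply (hD i) (measurableSet_singleton o),
        Measure.map_apply (hD 0) (measurableSet_singleton o), ← measureReal_eq_measureReal_iff,
        hlaw, hlaw]⟩
  have hint : ∀ g : LDPQuantile.Obs d → ℝ,
      ∫ ω, g (D 0 ω) ∂μ = ∑ o, p.trueProb FX F o * g o := fun g => by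
    have := Measure.isProbabilityMeasure_map (μ := μ) (hD 0).aemeasurable
    rw [← integral_map (hD 0).aemeasurable (f := g) (by fun_prop),
      integral_fintype (by exact .of_finite)]
    refine Finset.sum_congr rfl fun o _ => ?_
    rw [map_measureReal_apply (hD 0) (measurableSet_singleton o), hlaw, smul_eq_mul]
  have hφ : Measurable (p.influence FX F βs) := measurable_of_finite _
  have hbdd : ∃ c, ∀ o, ‖p.influence FX F βs o‖ ≤ c :=
    ⟨∑ o, ‖p.influence FX F βs o‖, fun o =>
      Finset.single_le_sum (f := fun o => ‖p.influence FX F βs o‖) (fun _ _ => norm_nonneg _)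
        (Finset.mem_univ o)⟩
  obtain ⟨c, hc⟩ := hbdd
  have hclt := tendstoInDistribution_inv_sqrt_smul_sum (μ := μ)
    (X := fun i ω => p.influence FX F βs (D i ω)) (hindep.comp (fun _ => _) fun _ => hφ)
    (fun i => (hident i).comp hφ)
    (MemLp.of_bound (hφ.comp (hD 0)).aestronglyMeasurable c (ae_of_all _ fun ω => hc _)) hC
    (fun t => by
      rw [hint fun o => inner ℝ t (p.influence FX F βs o)]
      simp_rw [← inner_smul_right]
      rw [← inner_sum, LDPQuantile.Params.sum_smul_influence_eq_zero hβs hmax, inner_zero_right])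
    (fun t => by
      rw [hint fun o => inner ℝ t (p.influence FX F βs o) ^ 2, p.sum_mul_inner_influence_sq])
  refine hclt.of_ae_isEquivalent (fun n => (measurable_const_smul _).comp_aemeasurable
    ((hmeas n).sub_const _)) ?_
  filter_upwards [ae_tendsto_frequency hindep hident, ae_all_iff.2 hβhat] with ω hfreq hω
  have h := LDPQuantile.Params.isEquivalent_of_isQMLE hΒ hβs hmax hA
    (D := fun i => D i ω) (fun o => hlaw 0 o ▸ hfreq o) hω
  refine ((Asymptotics.IsEquivalent.refl (u := fun n : ℕ => √(n : ℝ))).smul h).congr_right ?_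
  -- `√n * (1 / n) = (√n)⁻¹`, which with division by zero also holds for `n = 0`.
  refine Eventually.of_forall fun n => ?_
  simp only [smul_smul, mul_one_div, Real.sqrt_div_self]
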